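/- Let $n,k\ge 0$ and $p_0,\dots,p_n\in\mathbb Z^k$, and put $S=\{p_0,\dots,p_n\}$. Let $\varphi\colon(\mathbb C^*)^k\to\mathbb P^n$, $t\mapsto[t^{p_0}:\dots:t^{p_n}]$, be the monomial map with exponents $p_0,\dots,p_n$, let $X(S)\subseteq\mathbb P^n$ be the Zariski closure of its image, and let $\mathbf 1=\varphi(1,\dots,1)\in X(S)$. For an integer $m\ge 0$, the $m$-th fundamental form of $X(S)$ at $\mathbf 1$ is the following linear system of homogeneous polynomials of degree $m$ on $\mathbb C^k$. Consider all linear forms $\ell=\sum_i c_iz_i$ on $\mathbb P^n$ whose restriction to $X(S)$ vanishes at $\mathbf 1$ to order at least $m$, i.e. whose germ lies in $\mathfrak m^m$, where $\mathfrak m$ is the maximal ideal of the local ring of $X(S)$ at $\mathbf 1$ and $\ell$ is viewed near $\mathbf 1$ as the function $\ell/z_0$. The linear system consists of the leading forms of these $\ell$, i.e. of their classes in $\mathfrak m^m/\mathfrak m^{m+1}=\operatorname{Sym}^m(T^*_{X(S),\mathbf 1})$, regarded as polynomials on $\mathbb C^k$ through the differential $d\varphi_1\colon\mathbb C^k\to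 T_{X(S),\mathbf 1}$ (an isomorphism when $X(S)$ has dimension $k$, in which case $\mathbb P^{k-1}=\mathbb P(T_{X(S),\mathbf 1})$). A point $[v]\in\mathbb P^{k-1}$ is a base point of this linear system if all its members vanish at $v$. Theorem. Let $m\ge 2$ be an integer and let $v\in\mathbb C^k$ be a non-zero vector. The following are equivalent: (1) $[v]\in\mathbb P^{k-1}$ is a base point of the $m$-th fundamental form of $X(S)$ at $\mathbf 1$; (2) all points of $S$ lie on an affine hypersurface of $\mathbb C^k$ with an equation of the form $(v\cdot x)^m+R(x)=0$, where $R\in\mathbb C[x_1,\dots,x_k]$ has degree less than $m$ (possibly $R=0$) and $v\cdot x=\sum_j v_jx_j$. -/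

import Mathlib

open MvPolynomial
open scoped LinearAlgebra.Projectivization

/-- The homogeneous ideal of a set `Z` of points of projective `n`-space: the ideal generated by
the homogeneous polynomials that vanish at every point of `Z`. -/
noncomputable def homIdeal {n : ℕ} (Z : Set (ℙ ℂ (Fin (n + 1) → ℂ))) :
    Ideal (MvPolynomial (Fin (n + 1)) ℂ) :=
  Ideal.span {F | (∃ d, F.IsHomogeneous d) ∧ ∀ x ∈ Z, eval x.rep F = 0}

/-- The Zariski closure of a set of points of projective `n`-space: the common zeros of the
homogeneous polynomials that vanish on the set. -/
def zariskiClosure {n : ℕ} (Z : Set (ℙ ℂ (Fin (n + 1) → ℂ))) : Set (ℙ ℂ (Fin (n + 1) → ℂ)) :=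
  {x | ∀ (d : ℕ) (F : MvPolynomial (Fin (n + 1)) ℂ), F.IsHomogeneous d →
    (∀ z ∈ Z, eval z.rep F = 0) → eval x.rep F = 0}

/-- The linear form `c₀ z₀ + ⋯ + cₙ zₙ`. -/
noncomputable def linForm {n : ℕ} (c : Fin (n + 1) → ℂ) : MvPolynomial (Fin (n + 1)) ℂ :=
  ∑ i, C (c i) * X i

/-- The polynomial `A (q + τ w)` in the variables `w₁, …, w_k`. -/
noncomputable def expandAt {n k : ℕ} (q : Fin (n + 1) → ℂ)
    (τ : (Fin k → ℂ) →L[ℂ] (Fin (n + 1) → ℂ)) :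
    MvPolynomial (Fin (n + 1)) ℂ →ₐ[ℂ] MvPolynomial (Fin k) ℂ :=
  aeval fun i => C (q i) + ∑ j, C (τ (Pi.single j 1) i) * X j

theorem constantCoeff_expandAt {n k : ℕ} (q : Fin (n + 1) → ℂ)
    (τ : (Fin k → ℂ) →L[ℂ] (Fin (n + 1) → ℂ)) (A : MvPolynomial (Fin (n + 1)) ℂ) :
    constantCoeff (expandAt q τ A) = eval q A := by
  induction A using MvPolynomial.induction_on with
  | C a => simp [expandAt, algebraMap_eq]
  | add p r hp hr => simp [hp, hr]
  | mul_X p i hp => simp [hp]; simp [expandAt]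

theorem mem_idealOfVars_iff_constantCoeff {k : ℕ} (P : MvPolynomial (Fin k) ℂ) :
    P ∈ idealOfVars (Fin k) ℂ ↔ constantCoeff P = 0 := by
  rw [← pow_one (idealOfVars (Fin k) ℂ), mem_pow_idealOfVars_iff, constantCoeff_eq,
    ← notMem_support_iff]
  constructor
  · intro h h0
    simpa using h 0 h0
  · intro h x hx
    by_contra hlt
    have : x = 0 := by
      have : Finsupp.degree x = 0 := by omega
      exact (Finsupp.degree_eq_zero_iff x).1 this
    exact h (this ▸ hx)

theorem expandAt_mem {n k : ℕ} (q : Fin (n + 1) → ℂ) (hq : q ≠ 0)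
    (τ : (Fin k → ℂ) →L[ℂ] (Fin (n + 1) → ℂ)) (m : ℕ) {A : MvPolynomial (Fin (n + 1)) ℂ}
    (hA : A ∈ homIdeal {Projectivization.mk ℂ q hq} ^ m) :
    expandAt q τ A ∈ idealOfVars (Fin k) ℂ ^ m := by
  have h1 : homIdeal {Projectivization.mk ℂ q hq} ≤
      Ideal.comap (expandAt q τ) (idealOfVars (Fin k) ℂ) := by
    refine Ideal.span_le.2 ?_
    rintro F ⟨⟨d, hd⟩, hF⟩
    have hF := hF _ rfl
    obtain ⟨a, ha⟩ := Projectivization.exists_smul_eq_mk_rep ℂ q hq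
    rw [SetLike.mem_coe, Ideal.mem_comap, mem_idealOfVars_iff_constantCoeff,
      constantCoeff_expandAt]
    rw [← ha] at hF
    have h2 : eval ((a : ℂ) • q) F = (a : ℂ) ^ d * eval q F := by
      rw [eval_eq, eval_eq, Finset.mul_sum]
      refine Finset.sum_congr rfl fun x hx => ?_
      have hx' := hd (mem_support_iff.1 hx)
      rw [Finsupp.weight_apply, Finsupp.sum_fintype _ _ (by simp)] at hx'
      simp only [Pi.one_apply, smul_eq_mul, mul_one, Pi.smul_apply, mul_pow,
        Finset.prod_mul_distrib] at hx' ⊢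
      have h3 : ∏ i ∈ x.support, (a : ℂ) ^ x i = (a : ℂ) ^ d := by
        rw [Finset.prod_pow_eq_pow_sum, ← hx']
        congr 1
        exact Finset.sum_subset (Finset.subset_univ _) (by simp)
      rw [h3]
      ring
    have h4 : (a : ℂ) ^ d * eval q F = 0 := h2 ▸ hF
    exact (mul_eq_zero.1 h4).resolve_left (pow_ne_zero _ a.ne_zero)
  have h2 := Ideal.pow_right_mono h1 m hA
  exact Ideal.le_comap_pow _ _ h2

theorem homogeneousComponent_expandAt_mul {n k : ℕ} (q : Fin (n + 1) → ℂ) (hq : q ≠ 0)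
    (τ : (Fin k → ℂ) →L[ℂ] (Fin (n + 1) → ℂ)) (m : ℕ) {G A : MvPolynomial (Fin (n + 1)) ℂ}
    (hG : eval q G = 1) (hA : A ∈ homIdeal {Projectivization.mk ℂ q hq} ^ m) :
    homogeneousComponent m (expandAt q τ (G * A)) =
      homogeneousComponent m (expandAt q τ A) := by
  have h1 : expandAt q τ (G - 1) ∈ idealOfVars (Fin k) ℂ := by
    rw [mem_idealOfVars_iff_constantCoeff, constantCoeff_expandAt]
    simp [hG]
  have h2 : expandAt q τ ((G - 1) * A) ∈ idealOfVars (Fin k) ℂ ^ (m + 1) := by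
    rw [map_mul, pow_succ']
    exact Ideal.mul_mem_mul h1 (expandAt_mem q hq τ m hA)
  have h3 : homogeneousComponent m (expandAt q τ ((G - 1) * A)) = 0 := by
    rw [mem_pow_idealOfVars_iff] at h2
    refine homogeneousComponent_eq_zero' _ _ fun d hd => ?_
    have := h2 d hd
    omega
  have h4 : G * A = (G - 1) * A + A := by ring
  rw [h4, map_add, map_add, h3, zero_add]

/-- The `m`-th fundamental form of a projective variety `X` at a point `[q]`, as a linear system
of forms of degree `m` on the tangent space, where the tangent space is parametrised by a linear
map `τ` from `ℂ^k` to `ℂ^(n+1)` (tangent vectors of projective space at `[q]` being vectors of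
`ℂ^(n+1)` modulo `q`).

A hyperplane section `ℓ = 0` of `X` has multiplicity at least `m` at `[q]`, that is, `ℓ` is a
section of `π^* H - m E`, when its germ lies in the `m`-th power of the maximal ideal of the local
ring of `X` at `[q]`: near `[q]` the form `ℓ` equals, on `X`, a fraction `A / G` with `G (q) ≠ 0`
(normalised to `G (q) = 1`) and `A` in the `m`-th power of the ideal of `[q]`. The restriction of
this section to the exceptional divisor is its leading form, namely the part of degree `m` of
`A (q + τ w)`. -/
noncomputable def fundamentalForm {n k : ℕ} (X : Set (ℙ ℂ (Fin (n + 1) → ℂ)))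
    (q : Fin (n + 1) → ℂ) (hq : q ≠ 0) (τ : (Fin k → ℂ) →L[ℂ] (Fin (n + 1) → ℂ)) (m : ℕ) :
    Submodule ℂ (MvPolynomial (Fin k) ℂ) where
  carrier := {Φ | ∃ (c : Fin (n + 1) → ℂ) (d : ℕ) (G A : MvPolynomial (Fin (n + 1)) ℂ),
    G.IsHomogeneous d ∧ eval q G = 1 ∧
    A ∈ homIdeal {Projectivization.mk ℂ q hq} ^ m ∧
    G * linForm c - A ∈ homIdeal X ∧
    Φ = homogeneousComponent m (expandAt q τ A)}
  zero_mem' := ⟨0, 0, 1, 0, isHomogeneous_one _ _, by simp, zero_mem _, by simp [linForm],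
    by simp⟩
  add_mem' := by
    rintro Φ Ψ ⟨c, d, G, A, hG, hGq, hA, hX, rfl⟩ ⟨c', d', G', A', hG', hGq', hA', hX', rfl⟩
    refine ⟨c + c', d + d', G * G', G' * A + G * A', hG.mul hG', by simp [hGq, hGq'],
      add_mem (Ideal.mul_mem_left _ _ hA) (Ideal.mul_mem_left _ _ hA'), ?_, ?_⟩
    · have h : G * G' * linForm (c + c') - (G' * A + G * A') =
          G' * (G * linForm c - A) + G * (G' * linForm c' - A') := by
        simp only [linForm, Pi.add_apply, map_add, add_mul, Finset.sum_add_distrib]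
        ring
      rw [h]
      exact add_mem (Ideal.mul_mem_left _ _ hX) (Ideal.mul_mem_left _ _ hX')
    · rw [map_add, map_add, homogeneousComponent_expandAt_mul q hq τ m hGq' hA,
        homogeneousComponent_expandAt_mul q hq τ m hGq hA']
  smul_mem' := by
    rintro a Φ ⟨c, d, G, A, hG, hGq, hA, hX, rfl⟩
    refine ⟨a • c, d, G, C a * A, hG, hGq, Ideal.mul_mem_left _ _ hA, ?_, ?_⟩
    · have h : G * linForm (a • c) - C a * A = C a * (G * linForm c - A) := by
        simp only [linForm, Pi.smul_apply, smul_eq_mul, map_mul, mul_assoc, ← Finset.mul_sum]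
        ring
      rw [h]
      exact Ideal.mul_mem_left _ _ hX
    · rw [← smul_eq_C_mul, map_smul, map_smul]

/-- The base points in `ℙ^(k-1)` of a linear system of forms in `k` variables. -/
def baseLocus {k : ℕ} (W : Submodule ℂ (MvPolynomial (Fin k) ℂ)) : Set (ℙ ℂ (Fin k → ℂ)) :=
  {x | ∀ Φ ∈ W, eval x.rep Φ = 0}

/-- The vector of Laurent monomials with exponents `p₀, …, pₙ`. -/
noncomputable def monomialVec {n k : ℕ} (p : Fin (n + 1) → Fin k → ℤ) (t : Fin k → ℂ) :
    Fin (n + 1) → ℂ :=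
  fun i => ∏ j, t j ^ p i j

theorem monomialVec_ne_zero {n k : ℕ} (p : Fin (n + 1) → Fin k → ℤ) (t : Fin k → ℂˣ) :
    monomialVec p (fun j => (t j : ℂ)) ≠ 0 := by
  intro h
  have h0 := congrFun h 0
  simp only [monomialVec, Pi.zero_apply, Finset.prod_eq_zero_iff] at h0
  obtain ⟨j, -, hj⟩ := h0
  exact zpow_ne_zero _ (t j).ne_zero hj

/-- The monomial map from the torus `(ℂ^*)^k` to projective `n`-space. -/
noncomputable def monomialMap {n k : ℕ} (p : Fin (n + 1) → Fin k → ℤ) (t : Fin k → ℂˣ) :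
    ℙ ℂ (Fin (n + 1) → ℂ) :=
  Projectivization.mk ℂ (monomialVec p fun j => (t j : ℂ)) (monomialVec_ne_zero p t)

/-- The toric variety `X(S)`, the closure of the image of the monomial map. -/
def toricVariety {n k : ℕ} (p : Fin (n + 1) → Fin k → ℤ) : Set (ℙ ℂ (Fin (n + 1) → ℂ)) :=
  zariskiClosure (Set.range (monomialMap p))

/-- The `m`-th fundamental form of `X(S)` at the image of the neutral element of the torus. The
Lie algebra `ℂ^k` of the torus is mapped to the tangent space by the differential of the
monomial map at the neutral element. -/
noncomputable def toricFundamentalForm {n k : ℕ} (p : Fin (n + 1) → Fin k → ℤ) (m : ℕ) :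
    Submodule ℂ (MvPolynomial (Fin k) ℂ) :=
  fundamentalForm (toricVariety p) (monomialVec p fun _ => ((1 : ℂˣ) : ℂ))
    (monomialVec_ne_zero p fun _ => 1) (fderiv ℂ (monomialVec p) fun _ => 1) m

/-! ### Ring homomorphisms that agree to first order -/

/-! Pull everything back along the curves `s ↦ φ(exp(s u))`, `u ∈ ℂ^k`. There `z_i` becomes `exp(s
⟨p_i, u⟩)`, so `ℓ = ∑ c_i z_i` becomes `∑_d (∑_i c_i ⟨p_i, u⟩^d) s^d / d!`. If `ℓ` vanishes to order
`m`, then `∑ c_i ⟨p_i, u⟩^d = 0` for all `u` and `d < m`, and its leading form is `u ↦ ∑ c_i ⟨p_i,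
u⟩^m / m!` (`toric_leadingForm`). Powers of linear forms span all forms, so `c` annihilates the
values on `S` of every polynomial of degree less than `m` (`sum_mul_eval_eq_zero`).

Conversely, every such `c` gives a member of the fundamental form
(`exists_mem_toricFundamentalForm`). This is the harder half: vanishing to order `m` along all these
curves must imply membership in the `m`-th power of the maximal ideal. It rests on the smoothness of
the torus image at the neutral element, made explicit in `exists_mem_pow_idealOfVars`: linear
relations between exponents come from binomial equations, so a leading form that vanishes on the
tangent space can be removed at the cost of terms of higher order. No assumption that `X(S)` has
dimension `k` is needed.

Thus `[v]` is a base point iff every `c` orthogonal to the values of polynomials of degree less than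
`m` is orthogonal to `(⟨p_i, v⟩^m)_i`. By duality this means that the vector is itself the vector of
values of such a polynomial, namely `-R`. -/

theorem sub_mem_of_sub_X_mem {ι A S : Type*} [CommRing A] [CommRing S] [Algebra A S]
    {α β : MvPolynomial ι A →ₐ[A] S} {J : Ideal S} (h : ∀ i, α (X i) - β (X i) ∈ J)
    (F : MvPolynomial ι A) : α F - β F ∈ J := by
  induction F using MvPolynomial.induction_on with
  | C a => simp [← MvPolynomial.algebraMap_eq]
  | add p r hp hr =>
    rw [map_add, map_add, add_sub_add_comm]
    exact add_mem hp hr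
  | mul_X p i hp =>
    have h1 : α (p * X i) - β (p * X i) =
        (α p - β p) * α (X i) + β p * (α (X i) - β (X i)) := by
      rw [map_mul, map_mul]; ring
    rw [h1]
    exact add_mem (Ideal.mul_mem_right _ _ hp) (Ideal.mul_mem_left _ _ (h i))

/-- Two homomorphisms that agree modulo the square of an ideal have the same leading forms. -/
theorem sub_mem_pow_succ {ι A S : Type*} [CommRing A] [CommRing S] [Algebra A S]
    {α β : MvPolynomial ι A →ₐ[A] S} {K : Ideal (MvPolynomial ι A)} {J : Ideal S}
    (hα : K ≤ J.comap α) (h : ∀ i, α (X i) - β (X i) ∈ J ^ 2) (m : ℕ) {F : MvPolynomial ι A}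
    (hF : F ∈ K ^ m) : α F - β F ∈ J ^ (m + 1) := by
  have h2 := sub_mem_of_sub_X_mem h
  have hβ : K ≤ J.comap β := fun a ha => by
    have := sub_mem (Ideal.mem_comap.1 (hα ha)) (Ideal.pow_le_self two_ne_zero (h2 a))
    simpa using this
  induction m generalizing F with
  | zero => simpa using Ideal.pow_le_self two_ne_zero (h2 F)
  | succ m ih =>
    rw [pow_succ'] at hF
    induction hF using Submodule.mul_induction_on' with
    | mem_mul_mem a ha b hb =>
      -- The first summand lies in `J ^ 2 * J ^ m`, the second in `J * J ^ (m + 1)`.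
      have h1 : α (a * b) - β (a * b) = (α a - β a) * α b + β a * (α b - β b) := by
        rw [map_mul, map_mul]; ring
      rw [h1]
      refine add_mem ?_ ?_
      · rw [show m + 1 + 1 = 2 + m by ring, pow_add]
        exact Ideal.mul_mem_mul (h2 a) (Ideal.le_comap_pow _ _ (Ideal.pow_right_mono hα m hb))
      · rw [pow_succ']
        exact Ideal.mul_mem_mul (hβ ha) (ih hb)
    | add a _ b _ ha hb =>
      rw [map_add, map_add, add_sub_add_comm]
      exact add_mem ha hb

/-! ### Exponential power series -/

/-- The power series `exp (μ s)` in the variable `s`. -/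
noncomputable def expSeries (μ : ℂ) : PowerSeries ℂ :=
  PowerSeries.rescale μ (PowerSeries.exp ℂ)

theorem coeff_expSeries (μ : ℂ) (d : ℕ) :
    PowerSeries.coeff d (expSeries μ) = μ ^ d / d.factorial := by
  simp [expSeries, PowerSeries.coeff_rescale, PowerSeries.coeff_exp, div_eq_mul_inv]

theorem constantCoeff_expSeries (μ : ℂ) : PowerSeries.constantCoeff (expSeries μ) = 1 := by
  rw [← PowerSeries.coeff_zero_eq_constantCoeff_apply, coeff_expSeries]
  simp

theorem expSeries_zero : expSeries 0 = 1 := by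
  simp [expSeries]

theorem expSeries_add (μ ν : ℂ) : expSeries (μ + ν) = expSeries μ * expSeries ν :=
  (PowerSeries.exp_mul_exp_eq_exp_add μ ν).symm

theorem expSeries_nsmul (r : ℕ) (μ : ℂ) : expSeries (r * μ) = expSeries μ ^ r := by
  induction r with
  | zero => simp [expSeries_zero]
  | succ r ih => rw [pow_succ, ← ih, ← expSeries_add]; congr 1; push_cast; ring

theorem expSeries_sum {ι : Type*} (s : Finset ι) (μ : ι → ℂ) :
    expSeries (∑ i ∈ s, μ i) = ∏ i ∈ s, expSeries (μ i) := by
  classical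
  induction s using Finset.induction_on with
  | empty => simp [expSeries_zero]
  | insert i s hi ih => rw [Finset.sum_insert hi, Finset.prod_insert hi, expSeries_add, ih]

/-- Differentiating the exponential sum multiplies each `b i` by `μ i`; after `d` derivatives,
evaluate at `0`. -/
theorem sum_mul_pow_eq_zero {ι : Type*} (s : Finset ι) (μ : ι → ℂ) (d : ℕ) (b : ι → ℂ)
    (h : ∀ x : ℂ, ∑ i ∈ s, b i * Complex.exp (μ i * x) = 0) : ∑ i ∈ s, b i * μ i ^ d = 0 := by
  induction d generalizing b with
  | zero => simpa using h 0
  | succ d ih =>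
    have h1 : ∀ x : ℂ, ∑ i ∈ s, (b i * μ i) * Complex.exp (μ i * x) = 0 := by
      intro x
      have h2 : HasDerivAt (fun x => ∑ i ∈ s, b i * Complex.exp (μ i * x))
          (∑ i ∈ s, b i * (Complex.exp (μ i * x) * (μ i * 1))) x := by
        refine HasDerivAt.fun_sum fun i _ => ?_
        exact (((hasDerivAt_id x).const_mul (μ i)).cexp).const_mul (b i)
      have h3 : (fun x => ∑ i ∈ s, b i * Complex.exp (μ i * x)) = fun _ => 0 := funext h
      rw [h3] at h2
      rw [← h2.unique (hasDerivAt_const x (0 : ℂ))]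
      exact Finset.sum_congr rfl fun i _ => by ring
    rw [← ih _ h1]
    exact Finset.sum_congr rfl fun i _ => by ring

/-- A polynomial relation between the characters of a torus holds between the exponential series
given by their differentials. -/
theorem aeval_expSeries_eq_zero {ι κ : Type*} [Fintype ι] [Fintype κ] (d : ι → κ → ℤ)
    {F : MvPolynomial ι ℂ} (hF : ∀ t : κ → ℂˣ, eval (fun i => ∏ j, (t j : ℂ) ^ d i j) F = 0)
    (u : κ → ℂ) : aeval (fun i => expSeries (∑ j, (d i j : ℂ) * u j)) F = 0 := by
  set μ : (ι →₀ ℕ) → ℂ := fun a => ∑ i, (a i : ℂ) * ∑ j, (d i j : ℂ) * u j with hμ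
  -- On the one-parameter subgroup `t_j = exp(u_j x)` the monomial with exponent `a` becomes `exp(μ
  -- a * x)`.
  have h1 : ∀ x : ℂ, ∑ a ∈ F.support, coeff a F * Complex.exp (μ a * x) = 0 := by
    intro x
    rw [← hF fun j => Units.mk0 (Complex.exp (u j * x)) (Complex.exp_ne_zero _), eval_eq']
    refine Finset.sum_congr rfl fun a _ => ?_
    congr 1
    simp only [Units.val_mk0, ← Complex.exp_int_mul, ← Complex.exp_sum, ← Complex.exp_nat_mul, hμ]
    congr 1
    simp only [Finset.sum_mul, Finset.mul_sum]
    exact Finset.sum_congr rfl fun i _ => Finset.sum_congr rfl fun j _ => by ring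
  rw [aeval_def, eval₂_eq']
  ext r
  simp only [← expSeries_nsmul, ← expSeries_sum, map_sum, map_zero, PowerSeries.algebraMap_apply,
    PowerSeries.coeff_C_mul, coeff_expSeries, Algebra.algebraMap_self, RingHom.id_apply]
  have h2 := sum_mul_pow_eq_zero F.support μ r (fun a => coeff a F) h1
  rw [← zero_div (r.factorial : ℂ), ← h2, Finset.sum_div]
  exact Finset.sum_congr rfl fun a _ => by rw [mul_div_assoc]

/-- Restricting a polynomial to a line through the origin. -/
theorem coeff_aeval_C_mul_X {ι : Type*} (ν : ι → ℂ) (m : ℕ) (F : MvPolynomial ι ℂ) :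
    PowerSeries.coeff m (aeval (fun i => PowerSeries.C (ν i) * PowerSeries.X) F) =
      eval ν (homogeneousComponent m F) := by
  induction F using MvPolynomial.induction_on' with
  | monomial a c =>
    rw [aeval_monomial, Finsupp.prod]
    simp only [mul_pow, Finset.prod_mul_distrib, ← map_pow, ← map_prod, Finset.prod_pow_eq_pow_sum]
    rw [PowerSeries.algebraMap_apply, PowerSeries.coeff_C_mul, PowerSeries.coeff_C_mul,
      PowerSeries.coeff_X_pow, homogeneousComponent_of_mem (isHomogeneous_monomial c rfl)]
    split_ifs with h1 h2 h2
    · simp [eval_monomial, Finsupp.prod]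
    · exact absurd h1 h2
    · exact absurd h2 h1
    · simp
  | add p r hp hr => simp only [map_add, hp, hr]

theorem mem_span_X_pow_iff (m : ℕ) (f : PowerSeries ℂ) :
    f ∈ (Ideal.span {PowerSeries.X} : Ideal (PowerSeries ℂ)) ^ m ↔
      ∀ d < m, PowerSeries.coeff d f = 0 := by
  rw [Ideal.span_singleton_pow, Ideal.mem_span_singleton, PowerSeries.X_pow_dvd_iff]

theorem mem_span_X_iff (f : PowerSeries ℂ) :
    f ∈ (Ideal.span {PowerSeries.X} : Ideal (PowerSeries ℂ)) ↔
      PowerSeries.constantCoeff f = 0 := by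
  rw [Ideal.mem_span_singleton, PowerSeries.X_dvd_iff]

/-- `exp (μ s) ≡ 1 + μ s` modulo `s ^ 2`. -/
theorem expSeries_sub_mem (μ : ℂ) : expSeries μ - (1 + PowerSeries.C μ * PowerSeries.X) ∈
    (Ideal.span {PowerSeries.X} : Ideal (PowerSeries ℂ)) ^ 2 := by
  rw [mem_span_X_pow_iff]
  intro d hd
  interval_cases d <;> simp [constantCoeff_expSeries, coeff_expSeries, PowerSeries.coeff_one]

/-! ### From the fundamental form to the exponents -/

theorem IsHomogeneous.eval_rep_mk_eq_zero_iff {n d : ℕ} {F : MvPolynomial (Fin (n + 1)) ℂ}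
    (hF : F.IsHomogeneous d) {x : Fin (n + 1) → ℂ} (hx : x ≠ 0) :
    eval (Projectivization.mk ℂ x hx).rep F = 0 ↔ eval x F = 0 := by
  obtain ⟨a, ha⟩ := Projectivization.exists_smul_eq_mk_rep ℂ x hx
  have h : eval ((a : ℂ) • x) F = (a : ℂ) ^ d * eval x F := by
    rw [eval_eq', eval_eq', Finset.mul_sum]
    refine Finset.sum_congr rfl fun b hb => ?_
    simp only [Pi.smul_apply, smul_eq_mul, mul_pow, Finset.prod_mul_distrib,
      Finset.prod_pow_eq_pow_sum]
    rw [← Finsupp.degree_eq_sum, Finsupp.degree_apply, ← hF.degree_eq_sum_deg_support hb]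
    ring
  rw [← ha]
  change eval ((a : ℂ) • x) F = 0 ↔ _
  rw [h, mul_eq_zero, or_iff_right (pow_ne_zero _ a.ne_zero)]

theorem eval_eq_zero_of_mem_homIdeal {n k : ℕ} {p : Fin (n + 1) → Fin k → ℤ}
    {F : MvPolynomial (Fin (n + 1)) ℂ} (hF : F ∈ homIdeal (toricVariety p)) (t : Fin k → ℂˣ) :
    eval (monomialVec p fun j => (t j : ℂ)) F = 0 := by
  have h : homIdeal (toricVariety p) ≤
      RingHom.ker (eval (monomialVec p fun j => (t j : ℂ))) := by
    refine Ideal.span_le.2 ?_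
    rintro F ⟨⟨d, hd⟩, hF⟩
    exact (IsHomogeneous.eval_rep_mk_eq_zero_iff hd (monomialVec_ne_zero p t)).1
      (hF (monomialMap p t) fun d' F' _ h => h _ ⟨t, rfl⟩)
  exact h hF

theorem mem_homIdeal_toricVariety {n k d : ℕ} {p : Fin (n + 1) → Fin k → ℤ}
    {F : MvPolynomial (Fin (n + 1)) ℂ} (hF : F.IsHomogeneous d)
    (h : ∀ t : Fin k → ℂˣ, eval (monomialVec p fun j => (t j : ℂ)) F = 0) :
    F ∈ homIdeal (toricVariety p) := by
  refine Ideal.subset_span ⟨⟨d, hF⟩, fun x hx => hx d F hF ?_⟩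
  rintro _ ⟨t, rfl⟩
  exact (IsHomogeneous.eval_rep_mk_eq_zero_iff hF (monomialVec_ne_zero p t)).2 (h t)

theorem monomialVec_one {n k : ℕ} (p : Fin (n + 1) → Fin k → ℤ) :
    monomialVec p (fun _ => ((1 : ℂˣ) : ℂ)) = 1 := by
  ext i; simp [monomialVec]

theorem fderiv_monomialVec_one {n k : ℕ} (p : Fin (n + 1) → Fin k → ℤ) (i : Fin (n + 1))
    (j : Fin k) : fderiv ℂ (monomialVec p) (fun _ => 1) (Pi.single j 1) i = p i j := by
  have h : HasFDerivAt (monomialVec p) (ContinuousLinearMap.pi fun i =>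
      ∑ j, (p i j : ℂ) • ContinuousLinearMap.proj (R := ℂ) (φ := fun _ : Fin k => ℂ) j)
      (fun _ => 1) := by
    refine hasFDerivAt_pi.2 fun i => ?_
    have h1 : ∀ j ∈ Finset.univ, HasFDerivAt (fun t : Fin k → ℂ => t j ^ p i j)
        ((p i j : ℂ) • ContinuousLinearMap.proj (R := ℂ) (φ := fun _ : Fin k => ℂ) j)
        (fun _ => 1) := by
      intro j _
      have h2 := (hasDerivAt_zpow (p i j) (1 : ℂ) (Or.inl one_ne_zero)).comp_hasFDerivAt
        (fun _ : Fin k => (1 : ℂ))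
        (ContinuousLinearMap.proj (R := ℂ) (φ := fun _ : Fin k => ℂ) j).hasFDerivAt
      simp only [zpow_sub_one₀ one_ne_zero, one_zpow, inv_one, mul_one] at h2
      exact h2
    have h2 := HasFDerivAt.finsetProd h1
    simp only [one_zpow, Finset.prod_const_one, one_smul] at h2
    exact h2
  rw [h.fderiv]
  simp [Pi.single_apply]

theorem constantCoeff_aeval {ι : Type*} (f : ι → PowerSeries ℂ) (F : MvPolynomial ι ℂ) :
    PowerSeries.constantCoeff (aeval f F) =
      eval (fun i => PowerSeries.constantCoeff (f i)) F := by
  induction F using MvPolynomial.induction_on with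
  | C a => simp
  | add p r hp hr => simp [hp, hr]
  | mul_X p i hp => simp [hp]

/-- A unit congruent to `1` changes neither the order nor the leading coefficient. This disposes of
the denominator `G`. -/
theorem coeff_mul_eq_of_constantCoeff {f g : PowerSeries ℂ} {m : ℕ}
    (hf : PowerSeries.constantCoeff f = 1)
    (h : f * g ∈ (Ideal.span {PowerSeries.X} : Ideal (PowerSeries ℂ)) ^ m) :
    (∀ d < m, PowerSeries.coeff d g = 0) ∧
      PowerSeries.coeff m g = PowerSeries.coeff m (f * g) := by
  have h1 : g ∈ (Ideal.span {PowerSeries.X} : Ideal (PowerSeries ℂ)) ^ m := by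
    have hu : IsUnit f := PowerSeries.isUnit_iff_constantCoeff.2 (by simp [hf])
    exact (Ideal.unit_mul_mem_iff_mem _ hu).1 h
  have h2 : (f - 1) * g ∈ (Ideal.span {PowerSeries.X} : Ideal (PowerSeries ℂ)) ^ (m + 1) := by
    rw [pow_succ']
    exact Ideal.mul_mem_mul ((mem_span_X_iff _).2 (by simp [hf])) h1
  refine ⟨(mem_span_X_pow_iff m g).1 h1, ?_⟩
  have h3 := (mem_span_X_pow_iff _ _).1 h2 m (Nat.lt_succ_self m)
  rw [sub_mul, one_mul, map_sub, sub_eq_zero] at h3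
  exact h3.symm

/-- A linear form that vanishes to order `m` on the toric variety, in terms of the exponents. -/
theorem toric_leadingForm {n k : ℕ} {p : Fin (n + 1) → Fin k → ℤ} {m : ℕ}
    {c : Fin (n + 1) → ℂ} {G A : MvPolynomial (Fin (n + 1)) ℂ}
    (hG : eval (monomialVec p fun _ => ((1 : ℂˣ) : ℂ)) G = 1)
    (hA : A ∈ homIdeal {Projectivization.mk ℂ (monomialVec p fun _ => ((1 : ℂˣ) : ℂ))
      (monomialVec_ne_zero p fun _ => 1)} ^ m)
    (hX : G * linForm c - A ∈ homIdeal (toricVariety p)) (u : Fin k → ℂ) :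
    (∀ d < m, ∑ i, c i * (∑ j, (p i j : ℂ) * u j) ^ d = 0) ∧
      eval u (homogeneousComponent m (expandAt (monomialVec p fun _ => ((1 : ℂˣ) : ℂ))
        (fderiv ℂ (monomialVec p) fun _ => 1) A)) =
        (∑ i, c i * (∑ j, (p i j : ℂ) * u j) ^ m) / m.factorial := by
  set q := monomialVec p fun _ => ((1 : ℂˣ) : ℂ) with hq
  set τ := fderiv ℂ (monomialVec p) fun _ => 1 with hτ
  set μ : Fin (n + 1) → ℂ := fun i => ∑ j, (p i j : ℂ) * u j with hμ
  have hq1 : q = fun _ => 1 := monomialVec_one p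
  -- `α` restricts to the curve `φ(exp(s u))`, and `β` to its tangent line `q + s τ(u)`; they agree
  -- modulo `s ^ 2`.
  set α : MvPolynomial (Fin (n + 1)) ℂ →ₐ[ℂ] PowerSeries ℂ := aeval fun i => expSeries (μ i) with hα
  set β : MvPolynomial (Fin (n + 1)) ℂ →ₐ[ℂ] PowerSeries ℂ :=
    (aeval fun j => PowerSeries.C (u j) * PowerSeries.X).comp (expandAt q τ) with hβ
  have hcc : ∀ F, PowerSeries.constantCoeff (α F) = eval q F := fun F => by
    rw [hα, constantCoeff_aeval, hq1]
    simp only [constantCoeff_expSeries]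
  have hK : homIdeal {Projectivization.mk ℂ q (monomialVec_ne_zero p fun _ => 1)} ≤
      (Ideal.span {PowerSeries.X} : Ideal (PowerSeries ℂ)).comap α := fun F hF => by
    rw [Ideal.mem_comap, mem_span_X_iff, hcc, ← constantCoeff_expandAt q τ,
      ← mem_idealOfVars_iff_constantCoeff, ← pow_one (idealOfVars (Fin k) ℂ)]
    exact expandAt_mem q _ τ 1 (by rwa [pow_one])
  have hαβ : ∀ i, α (X i) - β (X i) ∈
      (Ideal.span {PowerSeries.X} : Ideal (PowerSeries ℂ)) ^ 2 := fun i => by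
    have h1 : β (X i) = 1 + PowerSeries.C (μ i) * PowerSeries.X := by
      simp only [hβ, AlgHom.comp_apply, expandAt, aeval_X, hτ, fderiv_monomialVec_one, map_add,
        map_sum, map_mul, ← algebraMap_eq, AlgHom.commutes, PowerSeries.algebraMap_apply, hq1, hμ,
        Finset.sum_mul, Algebra.algebraMap_self, RingHom.id_apply, map_one, mul_assoc]
    rw [h1, hα, aeval_X]
    exact expSeries_sub_mem _
  have hlin : ∀ d, PowerSeries.coeff d (α (linForm c)) = (∑ i, c i * μ i ^ d) / d.factorial := by
    intro d
    simp only [linForm, map_sum, map_mul, ← algebraMap_eq, AlgHom.commutes, hα, aeval_X,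
      PowerSeries.algebraMap_apply, PowerSeries.coeff_C_mul, coeff_expSeries, Finset.sum_div,
      mul_div_assoc, Algebra.algebraMap_self, RingHom.id_apply]
  have hGA : α G * α (linForm c) = α A := by
    have := aeval_expSeries_eq_zero p (fun t => eval_eq_zero_of_mem_homIdeal hX t) u
    rwa [← hα, map_sub, map_mul, sub_eq_zero] at this
  have hAm : α A ∈ (Ideal.span {PowerSeries.X} : Ideal (PowerSeries ℂ)) ^ m :=
    Ideal.le_comap_pow _ _ (Ideal.pow_right_mono hK m hA)
  obtain ⟨h1, h2⟩ := coeff_mul_eq_of_constantCoeff (by rw [hcc, hG]) (hGA ▸ hAm)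
  refine ⟨fun d hd => ?_, ?_⟩
  · have := h1 d hd
    rw [hlin, div_eq_zero_iff] at this
    exact this.resolve_right (Nat.cast_ne_zero.2 d.factorial_ne_zero)
  · have h3 := (mem_span_X_pow_iff _ _).1 (sub_mem_pow_succ hK hαβ m hA) m (Nat.lt_succ_self m)
    rw [map_sub, sub_eq_zero] at h3
    rw [← hlin, h2, hGA, h3, hβ, AlgHom.comp_apply, coeff_aeval_C_mul_X]

/-! ### Local equations of the toric variety at the neutral element -/

/-- The polynomials in the local coordinates `t ^ d i - 1` that vanish on the torus. -/
noncomputable def relationIdeal {ι κ : Type*} [Fintype κ] (d : ι → κ → ℤ) :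
    Ideal (MvPolynomial ι ℂ) :=
  ⨅ t : κ → ℂˣ, RingHom.ker (eval fun i => ∏ j, (t j : ℂ) ^ d i j - 1)

theorem mem_relationIdeal {ι κ : Type*} [Fintype κ] {d : ι → κ → ℤ} {F : MvPolynomial ι ℂ} :
    F ∈ relationIdeal d ↔
      ∀ t : κ → ℂˣ, eval (fun i => ∏ j, (t j : ℂ) ^ d i j - 1) F = 0 := by
  simp [relationIdeal, RingHom.mem_ker]

theorem aeval_expSeries_sub_one_eq_zero {ι κ : Type*} [Fintype ι] [Fintype κ] {d : ι → κ → ℤ}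
    {F : MvPolynomial ι ℂ} (hF : F ∈ relationIdeal d) (u : κ → ℂ) :
    aeval (fun i => expSeries (∑ j, (d i j : ℂ) * u j) - 1) F = 0 := by
  -- Translating the coordinates by `1` turns `F` into a relation between the characters themselves.
  have h := aeval_expSeries_eq_zero d (F := aeval (fun i => X i - 1) F) (fun t => ?_) u
  · rw [← AlgHom.comp_apply, comp_aeval] at h
    simpa using h
  · rw [← mem_relationIdeal.1 hF t, ← coe_aeval_eq_eval, ← coe_aeval_eq_eval]
    change aeval _ _ = aeval _ _
    rw [← AlgHom.comp_apply, comp_aeval]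
    simp

/-- Modulo `J ^ 2`, elements `1 + y` with `y ∈ J` multiply by adding the `y`: this linearises
monomials in the characters. -/
theorem prod_one_add_pow_sub_mem {ι A : Type*} [CommRing A] {J : Ideal A} {x : ι → A}
    (hx : ∀ i, x i ∈ J) (r : ι → ℕ) (s : Finset ι) :
    ∏ i ∈ s, (1 + x i) ^ r i - (1 + ∑ i ∈ s, (r i : A) * x i) ∈ J ^ 2 := by
  classical
  have hmul : ∀ a b y z : A, y ∈ J → z ∈ J → a - (1 + y) ∈ J ^ 2 → b - (1 + z) ∈ J ^ 2 →
      a * b - (1 + (y + z)) ∈ J ^ 2 := by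
    intro a b y z hy hz ha hb
    have h : a * b - (1 + (y + z)) = (a - (1 + y)) * b + (1 + y) * (b - (1 + z)) + y * z := by
      ring
    rw [h, sq]
    rw [sq] at ha hb
    exact add_mem (add_mem (Ideal.mul_mem_right _ _ ha) (Ideal.mul_mem_left _ _ hb))
      (Ideal.mul_mem_mul hy hz)
  have hpow : ∀ (i : ι) (e : ℕ), (1 + x i) ^ e - (1 + (e : A) * x i) ∈ J ^ 2 := by
    intro i e
    induction e with
    | zero => simp
    | succ e ih =>
      have := hmul _ (1 + x i) _ (x i) (Ideal.mul_mem_left _ _ (hx i)) (hx i) ih (by simp)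
      rw [pow_succ (1 + x i)]
      rwa [Nat.cast_succ, add_mul, one_mul]
  induction s using Finset.induction_on with
  | empty => simp
  | insert i s hi ih =>
    rw [Finset.prod_insert hi, Finset.sum_insert hi]
    exact hmul _ _ _ _ (Ideal.mul_mem_left _ _ (hx i))
      (Ideal.sum_mem _ fun j _ => Ideal.mul_mem_left _ _ (hx j)) (hpow i _) ih

/-- An integral linear relation between exponents gives a relation between the coordinates to
first order. -/
theorem sum_intCast_mul_X_mem {ι κ : Type*} [Fintype ι] [Fintype κ] {d : ι → κ → ℤ} {a : ι → ℤ}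
    (ha : ∀ j, ∑ i, a i * d i j = 0) :
    ∑ i, C (a i : ℂ) * X i ∈ idealOfVars ι ℂ ^ 2 ⊔ relationIdeal d := by
  -- The character `t ^ d i` is `1 + X i`. Splitting `a` into positive and negative parts turns `∏
  -- (t ^ d i) ^ a i = 1` into a binomial equation without negative exponents.
  set M : (ι → ℕ) → MvPolynomial ι ℂ := fun r => ∏ i, (1 + X i) ^ r i with hM
  have hX : ∀ i : ι, (X i : MvPolynomial ι ℂ) ∈ idealOfVars ι ℂ := fun i =>
    Ideal.subset_span ⟨i, rfl⟩
  have h1 := fun r : ι → ℕ => prod_one_add_pow_sub_mem hX r Finset.univ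
  have h2 : M (fun i => (a i).toNat) - M (fun i => (-a i).toNat) ∈ relationIdeal d := by
    refine mem_relationIdeal.2 fun t => ?_
    have h3 : ∀ i, (∏ j, (t j : ℂ) ^ d i j) ≠ 0 := fun i =>
      Finset.prod_ne_zero_iff.2 fun j _ => zpow_ne_zero _ (t j).ne_zero
    have h4 : ∏ i, (∏ j, (t j : ℂ) ^ d i j) ^ a i = 1 := by
      simp only [← Finset.prod_zpow, ← zpow_mul]
      rw [Finset.prod_comm]
      refine Finset.prod_eq_one fun j _ => ?_
      have h5 : ∀ s : Finset ι, ∏ i ∈ s, (t j : ℂ) ^ (d i j * a i) =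
          (t j : ℂ) ^ ∑ i ∈ s, a i * d i j := by
        classical
        intro s
        induction s using Finset.induction_on with
        | empty => simp
        | insert i s hi ih =>
          rw [Finset.prod_insert hi, Finset.sum_insert hi, ih, zpow_add₀ (t j).ne_zero, mul_comm]
          rw [mul_comm (d i j), mul_comm]
      rw [h5, ha, zpow_zero]
    simp only [hM, map_sub, map_prod, map_pow, map_add, map_one, eval_X, add_sub_cancel]
    rw [sub_eq_zero, ← mul_one (∏ i, _ ^ (-a i).toNat), ← h4, ← Finset.prod_mul_distrib]
    refine Finset.prod_congr rfl fun i _ => ?_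
    rw [← zpow_natCast, ← zpow_natCast, ← zpow_add₀ (h3 i)]
    congr 1
    omega
  have h3 : ∑ i, C (a i : ℂ) * X i = (M (fun i => (-a i).toNat) -
      (1 + ∑ i, (((-a i).toNat : ℕ) : MvPolynomial ι ℂ) * X i)) -
      (M (fun i => (a i).toNat) - (1 + ∑ i, (((a i).toNat : ℕ) : MvPolynomial ι ℂ) * X i)) +
      (M (fun i => (a i).toNat) - M (fun i => (-a i).toNat)) := by
    have h4 : ∀ i, (C (a i : ℂ) : MvPolynomial ι ℂ) * X i =
        (((a i).toNat : ℕ) : MvPolynomial ι ℂ) * X i -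
          (((-a i).toNat : ℕ) : MvPolynomial ι ℂ) * X i := by
      intro i
      rw [← sub_mul, map_intCast]
      congr 1
      have h5 : a i = ((a i).toNat : ℤ) - ((-a i).toNat : ℤ) := by omega
      exact_mod_cast congrArg (Int.cast : ℤ → MvPolynomial ι ℂ) h5
    rw [Finset.sum_congr rfl fun i _ => h4 i, Finset.sum_sub_distrib]
    ring
  rw [h3]
  exact add_mem (Ideal.mem_sup_left (sub_mem (h1 _) (h1 _))) (Ideal.mem_sup_right h2)

theorem sum_ratCast_mul_X_mem {ι κ : Type*} [Fintype ι] [Fintype κ] {d : ι → κ → ℤ} {r : ι → ℚ}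
    (hr : ∀ j, ∑ i, r i * d i j = 0) :
    ∑ i, C (r i : ℂ) * X i ∈ idealOfVars ι ℂ ^ 2 ⊔ relationIdeal d := by
  obtain ⟨⟨N, hN⟩, h⟩ := IsLocalization.exist_integer_multiples_of_finset (nonZeroDivisors ℤ)
    (Finset.univ.image r)
  choose a ha using fun i => h (r i) (Finset.mem_image_of_mem _ (Finset.mem_univ i))
  have ha' : ∀ i, (a i : ℚ) = N * r i := fun i => by simpa [Submonoid.smul_def] using ha i
  have hN0 : (N : ℂ) ≠ 0 := Int.cast_ne_zero.2 (nonZeroDivisors.ne_zero hN)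
  have h1 := sum_intCast_mul_X_mem (d := d) (a := a) fun j => by
    have h2 : ((∑ i, a i * d i j : ℤ) : ℚ) = 0 := by
      push_cast
      simp only [ha', mul_assoc, ← Finset.mul_sum, hr, mul_zero]
    exact_mod_cast h2
  have h3 : ∑ i, C (r i : ℂ) * X i = C ((N : ℂ)⁻¹) * ∑ i, C (a i : ℂ) * (X i : MvPolynomial ι ℂ) := by
    rw [Finset.mul_sum]
    refine Finset.sum_congr rfl fun i _ => ?_
    rw [← mul_assoc, ← C_mul]
    congr 2
    have : (a i : ℂ) = N * r i := by exact_mod_cast congrArg (Rat.cast : ℚ → ℂ) (ha' i)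
    rw [this, inv_mul_cancel_left₀ hN0]
  rw [h3]
  exact Ideal.mul_mem_left _ _ h1

theorem LinearMap.exists_comp_comp_eq {K V W : Type*} [DivisionRing K] [AddCommGroup V]
    [Module K V] [AddCommGroup W] [Module K W] (f : V →ₗ[K] W) :
    ∃ g : W →ₗ[K] V, ∀ x, f (g (f x)) = f x := by
  obtain ⟨s, hs⟩ := f.rangeRestrict.exists_rightInverse_of_surjective
    (LinearMap.range_eq_top.2 f.surjective_rangeRestrict)
  obtain ⟨g, hg⟩ := LinearMap.exists_extend s
  refine ⟨g, fun x => ?_⟩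
  have h1 := LinearMap.congr_fun hg (f.rangeRestrict x)
  have h2 := congrArg Subtype.val (LinearMap.congr_fun hs (f.rangeRestrict x))
  rw [LinearMap.comp_apply, ← h1] at h2
  exact h2

/-- The rows of `1 - d ρ` are linear relations between the exponents. Since `ρ` is rational,
clearing denominators makes them integral, as binomial equations require. -/
theorem exists_generalized_inverse {ι κ : Type*} [Fintype ι] [Fintype κ] (d : ι → κ → ℤ) :
    ∃ ρ : κ → ι → ℚ, ∀ i j, ∑ l, (∑ a, (d i a : ℚ) * ρ a l) * d l j = d i j := by
  classical
  obtain ⟨g, hg⟩ := LinearMap.exists_comp_comp_eq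
    (Matrix.vecMulLinear (Matrix.of fun i j => (d i j : ℚ)))
  refine ⟨fun a => g fun b => if a = b then 1 else 0, fun i j => ?_⟩
  have h := congrFun (hg (Pi.single i 1)) j
  rw [LinearMap.pi_apply_eq_sum_univ g] at h
  simp only [Matrix.vecMulLinear_apply, Matrix.of_apply, Matrix.vecMul, dotProduct,
    Finset.sum_apply, Pi.smul_apply, smul_eq_mul, Pi.single_apply, ite_mul, one_mul, zero_mul,
    Finset.sum_ite_eq', Finset.mem_univ, if_true] at h
  exact h

/-- A function of the coordinates whose restriction to the torus vanishes to order `m` at the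
neutral element is, up to relations, a polynomial of order `m` in the local coordinates. -/
theorem exists_mem_pow_idealOfVars {ι κ : Type*} [Fintype ι] [Fintype κ] (d : ι → κ → ℤ)
    (f : MvPolynomial ι ℂ) (m : ℕ) (hf : ∀ u : κ → ℂ, ∀ r < m, PowerSeries.coeff r
      (aeval (fun i => expSeries (∑ j, (d i j : ℂ) * u j) - 1) f) = 0) :
    ∃ B ∈ idealOfVars ι ℂ ^ m, f - B ∈ relationIdeal d := by
  induction m with
  | zero => exact ⟨f, by simp, by simp⟩
  | succ m ih =>
    obtain ⟨B, hB, hfB⟩ := ih fun u r hr => hf u r (hr.trans (Nat.lt_succ_self m))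
    have hcoord : ∀ ν : ι → ℂ, idealOfVars ι ℂ ≤
        (Ideal.span {PowerSeries.X}).comap (aeval (R := ℂ) fun i => expSeries (ν i) - 1) := by
      intro ν
      refine Ideal.span_le.2 ?_
      rintro _ ⟨i, rfl⟩
      rw [SetLike.mem_coe, Ideal.mem_comap, aeval_X, mem_span_X_iff]
      simp [constantCoeff_expSeries]
    set lam : MvPolynomial ι ℂ →ₐ[ℂ] MvPolynomial κ ℂ :=
      aeval fun i => ∑ j, C (d i j : ℂ) * X j with hlam
    -- `f` and `B` agree on the torus, so the coefficient of `s ^ m` of `f` along each curve is the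
    -- leading form of `B` at the tangent vector; by hypothesis it is zero.
    have hlead : lam (homogeneousComponent m B) = 0 := by
      refine MvPolynomial.funext fun u => ?_
      set ν : ι → ℂ := fun i => ∑ j, (d i j : ℂ) * u j with hν
      have h1 := (mem_span_X_pow_iff _ _).1 (sub_mem_pow_succ
        (β := aeval fun i => PowerSeries.C (ν i) * PowerSeries.X) (hcoord ν) (fun i => by
          rw [aeval_X, aeval_X, sub_sub]
          exact expSeries_sub_mem _) m hB) m (Nat.lt_succ_self m)
      have h2 := aeval_expSeries_sub_one_eq_zero hfB u
      rw [map_sub, sub_eq_zero] at h2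
      rw [map_sub, ← h2, hf u m (Nat.lt_succ_self m), coeff_aeval_C_mul_X, zero_sub,
        neg_eq_zero] at h1
      rw [map_zero, ← h1, ← coe_aeval_eq_eval, ← coe_aeval_eq_eval]
      change aeval _ _ = aeval _ _
      rw [hlam, ← AlgHom.comp_apply, comp_aeval]
      simp [hν]
    obtain ⟨ρ, hρ⟩ := exists_generalized_inverse d
    set E : MvPolynomial κ ℂ →ₐ[ℂ] MvPolynomial ι ℂ :=
      aeval fun j => ∑ l, C (ρ j l : ℂ) * X l with hE
    set J := (idealOfVars ι ℂ).map (Ideal.Quotient.mkₐ ℂ (relationIdeal d)) with hJ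
    have hhom : homogeneousComponent m B ∈ idealOfVars ι ℂ ^ m := by
      rw [mem_pow_idealOfVars_iff]
      intro x hx
      exact ((homogeneousComponent_isHomogeneous m B).degree_eq_sum_deg_support hx).le
    have hrest : B - homogeneousComponent m B ∈ idealOfVars ι ℂ ^ (m + 1) := by
      classical
      rw [mem_pow_idealOfVars_iff] at hB ⊢
      intro x hx
      rw [mem_support_iff, coeff_sub, coeff_homogeneousComponent] at hx
      split_ifs at hx with h
      · simp at hx
      · rw [sub_zero, ← mem_support_iff] at hx
        have := hB x hx
        omega
    -- Modulo relations and second order terms, `E ∘ lam` fixes every coordinate. The leading form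
    -- of `B` therefore agrees with its image under `E ∘ lam`, which is zero, up to order `m + 1`.
    have hdiff := sub_mem_pow_succ (α := Ideal.Quotient.mkₐ ℂ (relationIdeal d))
      (β := (Ideal.Quotient.mkₐ ℂ (relationIdeal d)).comp (E.comp lam)) (J := J)
      Ideal.le_comap_map (fun i => by
        have h1 : E (lam (X i)) = ∑ l, C ((∑ a, (d i a : ℚ) * ρ a l : ℚ) : ℂ) * X l := by
          simp only [hE, hlam, aeval_X, map_sum, map_mul, ← algebraMap_eq, AlgHom.commutes]
          simp only [Finset.mul_sum, Rat.cast_sum, map_sum, Finset.sum_mul, Rat.cast_mul,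
            Rat.cast_intCast, map_mul, mul_assoc]
          exact Finset.sum_comm
        have h2 : X i - E (lam (X i)) ∈ idealOfVars ι ℂ ^ 2 ⊔ relationIdeal d := by
          classical
          have h3 := sum_ratCast_mul_X_mem (d := d)
            (r := fun l => (if l = i then 1 else 0) - ∑ a, (d i a : ℚ) * ρ a l) fun j => by
              simp [sub_mul, hρ]
          convert h3 using 1
          rw [h1]
          simp [sub_mul, Finset.sum_sub_distrib, apply_ite (Rat.cast : ℚ → ℂ), apply_ite C]
        rw [AlgHom.comp_apply, AlgHom.comp_apply, ← map_sub, hJ, ← Ideal.map_pow,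
          ← Ideal.mem_comap, Ideal.comap_map_of_surjective _ (Ideal.Quotient.mkₐ_surjective _ _)]
        convert h2 using 2
        exact Ideal.mk_ker) m hhom
    rw [AlgHom.comp_apply, AlgHom.comp_apply, hlead, map_zero, map_zero, sub_zero, hJ,
      ← Ideal.map_pow, ← Ideal.mem_comap,
      Ideal.comap_map_of_surjective _ (Ideal.Quotient.mkₐ_surjective _ _)] at hdiff
    obtain ⟨b, hb, a, ha, hab⟩ := Submodule.mem_sup.1 hdiff
    have ha : a ∈ relationIdeal d := Ideal.Quotient.eq_zero_iff_mem.1 ha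
    refine ⟨B - homogeneousComponent m B + b, add_mem hrest hb, ?_⟩
    have : f - (B - homogeneousComponent m B + b) = f - B + a := by rw [← hab]; ring
    rw [this]
    exact add_mem hfB ha

/-! ### From the exponents to the fundamental form -/

/-- The homogenisation of a polynomial in the coordinates `zᵢ / z₀ - 1`, of degree `D`. -/
noncomputable def localHomogenization {n : ℕ} (D : ℕ) (B : MvPolynomial (Fin (n + 1)) ℂ) :
    MvPolynomial (Fin (n + 1)) ℂ :=
  ∑ b ∈ B.support, C (coeff b B) * (X 0 ^ (D - b.degree) * ∏ i, (X i - X 0) ^ b i)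

theorem localHomogenization_isHomogeneous {n D : ℕ} {B : MvPolynomial (Fin (n + 1)) ℂ}
    (hD : B.totalDegree ≤ D) : (localHomogenization D B).IsHomogeneous D := by
  refine IsHomogeneous.sum _ _ _ fun b hb => IsHomogeneous.C_mul ?_ _
  have hb' : b.degree ≤ D := (le_totalDegree hb).trans hD
  have h := (isHomogeneous_X_pow (R := ℂ) (0 : Fin (n + 1)) (D - b.degree)).mul
    (IsHomogeneous.prod Finset.univ (fun i => (X i - X 0 : MvPolynomial (Fin (n + 1)) ℂ) ^ b i)
      (fun i => 1 * b i) fun i _ => ((isHomogeneous_X ℂ i).sub (isHomogeneous_X ℂ 0)).pow _)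
  convert h using 1
  simp only [one_mul, ← Finsupp.degree_eq_sum]
  omega

theorem eval_localHomogenization {n D : ℕ} {B : MvPolynomial (Fin (n + 1)) ℂ}
    (hD : B.totalDegree ≤ D) (a : ℂ) {x : Fin (n + 1) → ℂ} (hx : x 0 = 1) :
    eval (fun i => a * x i) (localHomogenization D B) =
      a ^ D * eval (fun i => x i - 1) B := by
  rw [localHomogenization, map_sum, eval_eq', Finset.mul_sum]
  refine Finset.sum_congr rfl fun b hb => ?_
  have hb' : b.degree ≤ D := (le_totalDegree hb).trans hD
  have h : ∏ i, (a * x i - a) ^ b i = a ^ b.degree * ∏ i, (x i - 1) ^ b i := by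
    rw [Finsupp.degree_eq_sum, ← Finset.prod_pow_eq_pow_sum, ← Finset.prod_mul_distrib]
    exact Finset.prod_congr rfl fun i _ => by rw [← mul_pow, mul_sub, mul_one]
  simp only [map_mul, map_pow, map_prod, map_sub, eval_X, eval_C, hx, mul_one, h]
  rw [← pow_sub_mul_pow a hb']
  ring

theorem localHomogenization_mem {n m : ℕ} (D : ℕ) {B : MvPolynomial (Fin (n + 1)) ℂ}
    (hB : B ∈ idealOfVars (Fin (n + 1)) ℂ ^ m) {q : Fin (n + 1) → ℂ} (hq : q ≠ 0)
    (hq1 : q = 1) :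
    localHomogenization D B ∈ homIdeal {Projectivization.mk ℂ q hq} ^ m := by
  have hX : ∀ i, (X i - X 0 : MvPolynomial (Fin (n + 1)) ℂ) ∈
      homIdeal {Projectivization.mk ℂ q hq} := by
    intro i
    have h1 := (isHomogeneous_X ℂ i).sub (isHomogeneous_X ℂ (0 : Fin (n + 1)))
    refine Ideal.subset_span ⟨⟨1, h1⟩, ?_⟩
    rintro _ rfl
    exact (IsHomogeneous.eval_rep_mk_eq_zero_iff h1 hq).2 (by simp [hq1])
  refine Ideal.sum_mem _ fun b hb => Ideal.mul_mem_left _ _ (Ideal.mul_mem_left _ _ ?_)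
  refine Ideal.pow_le_pow_right ((mem_pow_idealOfVars_iff _ _).1 hB b hb) ?_
  rw [Finsupp.degree_eq_sum, ← Finset.prod_pow_eq_pow_sum]
  exact Ideal.prod_mem_prod fun i _ => Ideal.pow_mem_pow (hX i) _

/-- A linear form whose coefficients annihilate all polynomials of degree less than `m` on the
exponents vanishes to order `m` on the toric variety. -/
theorem exists_mem_toricFundamentalForm {n k : ℕ} (p : Fin (n + 1) → Fin k → ℤ) (m : ℕ)
    (c : Fin (n + 1) → ℂ) (hc : ∀ Q : MvPolynomial (Fin k) ℂ, Q.totalDegree < m →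
      ∑ i, c i * eval (fun j => (p i j : ℂ)) Q = 0) :
    ∃ Φ ∈ toricFundamentalForm p m, ∀ u : Fin k → ℂ,
      eval u Φ = (∑ i, c i * (∑ j, (p i j : ℂ) * u j) ^ m) / m.factorial := by
  -- These are the exponents of the affine coordinates `z_i / z_0`; with `X i` for `z_i / z_0 - 1`,
  -- the function `ℓ / z_0` is `∑ c_i (1 + X i)`.
  set d : Fin (n + 1) → Fin k → ℤ := fun i j => p i j - p 0 j with hd
  obtain ⟨B, hB, hfB⟩ := exists_mem_pow_idealOfVars d (∑ i, C (c i) * (1 + X i)) m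
    fun u r hr => by
      -- The test polynomial is `⟨x - p_0, u⟩ ^ r`, which accounts for the division by `z_0`.
      have h1 := hc ((∑ j, C (u j) * X j - C (∑ j, (p 0 j : ℂ) * u j)) ^ r) (by
        refine lt_of_le_of_lt (totalDegree_pow _ _) (lt_of_le_of_lt ?_ hr)
        refine mul_le_of_le_one_right (Nat.zero_le _) ((totalDegree_sub _ _).trans
          (max_le (totalDegree_finsetSum_le fun j _ => ?_)
            ((totalDegree_C _).trans_le zero_le_one)))
        exact (isHomogeneous_C_mul_X _ _).totalDegree_le)
      have h2 : ∑ i, c i * (∑ j, (d i j : ℂ) * u j) ^ r = 0 := by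
        rw [← h1]
        refine Finset.sum_congr rfl fun i _ => ?_
        simp only [hd, Int.cast_sub, sub_mul, Finset.sum_sub_distrib, map_pow, map_sub, map_sum,
          map_mul, eval_C, eval_X, mul_comm (u _)]
      simp only [map_sum, map_mul, ← algebraMap_eq, AlgHom.commutes, map_add, map_one, aeval_X,
        add_sub_cancel, PowerSeries.algebraMap_apply, PowerSeries.coeff_C_mul, coeff_expSeries,
        Algebra.algebraMap_self, RingHom.id_apply, ← mul_div_assoc, ← Finset.sum_div, h2,
        zero_div]
  have hlin : (linForm c).IsHomogeneous 1 :=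
    IsHomogeneous.sum _ _ _ fun i _ => isHomogeneous_C_mul_X _ _
  have hG := isHomogeneous_X_pow (R := ℂ) (0 : Fin (n + 1)) B.totalDegree
  have hGq : eval (monomialVec p fun _ => ((1 : ℂˣ) : ℂ)) (X 0 ^ B.totalDegree) = 1 := by
    rw [monomialVec_one, map_pow, eval_X, Pi.one_apply, one_pow]
  -- The extra `1` matches the degree of `X 0 ^ B.totalDegree * linForm c`.
  have hA := localHomogenization_mem (B.totalDegree + 1) hB
    (monomialVec_ne_zero p fun _ => 1) (monomialVec_one p)
  have hX : X 0 ^ B.totalDegree * linForm c - localHomogenization (B.totalDegree + 1) B ∈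
      homIdeal (toricVariety p) := by
    refine mem_homIdeal_toricVariety ((hG.mul hlin).sub
      (localHomogenization_isHomogeneous (Nat.le_succ _))) fun t => ?_
    set x : Fin (n + 1) → ℂ := fun i => ∏ j, (t j : ℂ) ^ d i j with hx
    have hz : (monomialVec p fun j => (t j : ℂ)) =
        fun i => (∏ j, (t j : ℂ) ^ p 0 j) * x i := by
      ext i
      rw [hx, monomialVec, ← Finset.prod_mul_distrib]
      refine Finset.prod_congr rfl fun j _ => ?_
      rw [← zpow_add₀ (t j).ne_zero, hd, add_sub_cancel]
    have hx0 : x 0 = 1 := by simp [hx, hd]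
    have h1 := mem_relationIdeal.1 hfB t
    rw [map_sub, sub_eq_zero] at h1
    rw [hz, map_sub, eval_localHomogenization (Nat.le_succ _) _ hx0, ← h1]
    simp only [linForm, map_mul, map_pow, map_sum, map_add, map_one, eval_X, eval_C, hx0,
      add_sub_cancel, mul_one, Finset.mul_sum, sub_eq_zero]
    exact Finset.sum_congr rfl fun i _ => by rw [hx, Nat.succ_eq_add_one]; ring
  exact ⟨_, ⟨c, _, _, _, hG, hGq, hA, hX, rfl⟩, fun u => (toric_leadingForm hGq hA hX u).2⟩

/-! ### Base points -/

/-- If the sums of all powers of linear forms of degree `d` vanish, so do those of all polynomials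
of degree `d`. -/
theorem sum_mul_eval_eq_zero {ι κ : Type*} [Fintype ι] [Fintype κ] (c : ι → ℂ)
    (x : ι → κ → ℂ) (m : ℕ)
    (h : ∀ u : κ → ℂ, ∀ d < m, ∑ i, c i * (∑ j, x i j * u j) ^ d = 0)
    {Q : MvPolynomial κ ℂ} (hQ : Q.totalDegree < m) : ∑ i, c i * eval (x i) Q = 0 := by
  have h1 : ∀ b : κ →₀ ℕ, b.degree < m → ∑ i, c i * ∏ j, x i j ^ b j = 0 := by
    intro b hb
    -- With `u` made indeterminate, the coefficient at `b` is the wanted sum times a multinomial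
    -- coefficient, nonzero in characteristic zero.
    have h2 : ∑ i, C (c i) * (∑ j, x i j • X j : MvPolynomial κ ℂ) ^ b.degree = 0 := by
      refine MvPolynomial.funext fun u => ?_
      simpa [smul_eval] using h u _ hb
    have h3 := congrArg (coeff b) h2
    have h4 : (b.multinomial : ℂ) ≠ 0 := by
      rw [Finsupp.multinomial_eq]
      exact Nat.cast_ne_zero.2 (Nat.multinomial_pos _ _).ne'
    simp only [coeff_sum, coeff_C_mul, coeff_linearCombination_X_pow_of_fintype, coeff_zero] at h3
    simp only [show (b.sum fun _ r => r) = b.degree from rfl, if_true, mul_left_comm (c _),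
      ← Finset.mul_sum] at h3
    rw [← (mul_eq_zero.1 h3).resolve_left h4]
    refine Finset.sum_congr rfl fun i _ => ?_
    rw [Finsupp.prod_fintype _ _ fun _ => pow_zero _]
  simp only [eval_eq', Finset.mul_sum]
  rw [Finset.sum_comm]
  refine Finset.sum_eq_zero fun b hb => ?_
  simp only [mul_left_comm (c _), ← Finset.mul_sum]
  rw [h1 b ((le_totalDegree hb).trans_lt hQ), mul_zero]

theorem mainTheorem1 {n k : ℕ} (p : Fin (n + 1) → Fin k → ℤ) (m : ℕ) (hm : 2 ≤ m)
    (v : Fin k → ℂ) (hv : v ≠ 0) :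
    Projectivization.mk ℂ v hv ∈ baseLocus (toricFundamentalForm p m) ↔
      ∃ R : MvPolynomial (Fin k) ℂ, R.totalDegree < m ∧
        ∀ i, eval (fun j => (p i j : ℂ)) ((∑ j, C (v j) * X j) ^ m + R) = 0 := by
  obtain ⟨a, ha⟩ := Projectivization.exists_smul_eq_mk_rep ℂ v hv
  have hrep : ∀ i, ∑ j, (p i j : ℂ) * (Projectivization.mk ℂ v hv).rep j =
      a * ∑ j, (p i j : ℂ) * v j := by
    intro i
    rw [← ha, Finset.mul_sum]
    exact Finset.sum_congr rfl fun j _ => by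
      rw [Pi.smul_apply, Units.smul_def, smul_eq_mul]; ring
  have hev : ∀ i (R : MvPolynomial (Fin k) ℂ), eval (fun j => (p i j : ℂ))
      ((∑ j, C (v j) * X j) ^ m + R) =
        (∑ j, (p i j : ℂ) * v j) ^ m + eval (fun j => (p i j : ℂ)) R := by
    intro i R
    simp [mul_comm]
  constructor
  · intro h
    set T : MvPolynomial (Fin k) ℂ →ₗ[ℂ] Fin (n + 1) → ℂ :=
      LinearMap.pi fun i => (aeval fun j => (p i j : ℂ)).toLinearMap with hT
    have hTi : ∀ Q i, T Q i = eval (fun j => (p i j : ℂ)) Q := fun Q i => by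
      rw [hT, LinearMap.pi_apply, AlgHom.toLinearMap_apply, ← coe_aeval_eq_eval]
      rfl
    -- Degree less than `m` is encoded as degree at most `m - 1`, which is legitimate because `m` is
    -- positive.
    by_cases hy : (fun i => (∑ j, (p i j : ℂ) * v j) ^ m) ∈
        (restrictTotalDegree (Fin k) ℂ (m - 1)).map T
    · obtain ⟨Q, hQ, hQy⟩ := hy
      have hQ' := (mem_restrictTotalDegree _ _ _).1 hQ
      refine ⟨-Q, by rw [totalDegree_neg]; omega, fun i => ?_⟩
      rw [hev, map_neg, ← hTi, hQy, add_neg_cancel]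
    · exfalso
      -- The coefficients of a functional separating the vector from the values of lower degree
      -- polynomials define a linear form whose leading form is nonzero at `v`.
      obtain ⟨φ, hφ, hker⟩ := Submodule.exists_le_ker_of_notMem hy
      set c : Fin (n + 1) → ℂ := fun i => φ (fun j => if i = j then 1 else 0) with hcdef
      have hφc : ∀ y, φ y = ∑ i, c i * y i := fun y => by
        rw [LinearMap.pi_apply_eq_sum_univ φ y]
        exact Finset.sum_congr rfl fun i _ => by rw [smul_eq_mul, mul_comm]
      obtain ⟨Φ, hΦ, hΦu⟩ := exists_mem_toricFundamentalForm p m c fun Q hQ => by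
        have h1 : T Q ∈ (restrictTotalDegree (Fin k) ℂ (m - 1)).map T :=
          ⟨Q, (mem_restrictTotalDegree _ _ _).2 (by omega), rfl⟩
        have h2 := hker h1
        rw [LinearMap.mem_ker, hφc] at h2
        simpa only [hTi] using h2
      have h3 := h Φ hΦ
      rw [hΦu, div_eq_zero_iff, or_iff_left (Nat.cast_ne_zero.2 m.factorial_ne_zero)] at h3
      simp only [hrep, mul_pow, mul_left_comm, ← Finset.mul_sum] at h3
      rw [hφc] at hφ
      exact hφ ((mul_eq_zero.1 h3).resolve_left (pow_ne_zero _ a.ne_zero))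
  · rintro ⟨R, hR, hpR⟩ Φ ⟨c, d, G, A, -, hG, hA, hX, rfl⟩
    have h1 := sum_mul_eval_eq_zero c (fun i j => (p i j : ℂ)) m
      (fun u => (toric_leadingForm hG hA hX u).1) hR
    rw [(toric_leadingForm hG hA hX _).2]
    simp only [hrep, mul_pow]
    have h2 : ∑ i, c i * (∑ j, (p i j : ℂ) * v j) ^ m = 0 := by
      rw [← neg_eq_zero, ← h1, ← Finset.sum_neg_distrib]
      refine Finset.sum_congr rfl fun i _ => ?_
      have h3 := hpR i
      rw [hev, add_eq_zero_iff_eq_neg] at h3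
      rw [h3, mul_neg, neg_neg]
    simp only [mul_left_comm (c _), ← Finset.mul_sum, h2, mul_zero, zero_div]
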